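/- Let $p$ be a prime, let $q$ be a power of $p$, and let $\sigma\colon x\mapsto x^p$ be the Frobenius automorphism of $\mathbb{F}_q$. For $g\ge 0$ let $W=\mathbb{F}_q^{2g}$ with its standard symplectic form $\omega$. A principally quasi-polarized (pqp) $\mathrm{DBT}_1$ on $(W,\omega)$ consists of a $\sigma$-semilinear map $F\colon W\to W$ and a $\sigma^{-1}$-semilinear map $V\colon W\to W$ with $\operatorname{im}F=\ker V$, $\operatorname{im}V=\ker F$ and $\omega(Fx,y)=\sigma(\omega(x,Vy))$ for all $x,y\in W$; here $V$ is determined by $F$. Fix for each $g$ such a structure with Frobenius $F_0$. A random pqp $\mathrm{DBT}_1$ of dimension $2g$ is the one with $F=AF_0B$, where $(A,B)$ is uniformly distributed in $\mathrm{Sp}(W)\times\mathrm{Sp}(W)$. Let $G$ be the finite commutative group scheme over $\mathbb{F}_q$ whose Dieudonné module is $(W,F,V)$. Then for every choice of the $F_0$ and every integer $d\ge 0$, the probability that the group $G(\mathbb{F}_q)$ has order $p^d$ converges, as $g\to\infty$, to $$p^{-d^2}\prod_{i=1}^{d}(1-p^{-i})^{-1}\prod_{j=d+1}^{\infty}(1-p^{-j}).$$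 -/

import Mathlib

open Filter Topology

/-! ### Modules with a semilinear Frobenius and Verschiebung -/

/-- A `DBT₁` over a perfect field `k` of characteristic `p`: a `k`-vector space with a
Frobenius-semilinear operator `F` and an inverse-Frobenius-semilinear operator `V` such that
`im F = ker V` and `im V = ker F` (in particular `FV = VF = 0`). -/
structure DBT1 (p : ℕ) [Fact p.Prime] (k : Type*) [Field k] [CharP k p] [PerfectRing k p]
    (W : Type*) [AddCommGroup W] [Module k W] where
  F : W →ₛₗ[((frobeniusEquiv k p : k ≃+* k) : k →+* k)] W
  V : W →ₛₗ[(((frobeniusEquiv k p).symm : k ≃+* k) : k →+* k)] W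
  range_F_eq_ker_V : ∀ x, (∃ y, F y = x) ↔ V x = 0
  range_V_eq_ker_F : ∀ x, (∃ y, V y = x) ↔ F x = 0

namespace DBT1

variable {p : ℕ} [Fact p.Prime] {k : Type*} [Field k] [CharP k p] [PerfectRing k p]
  {W : Type*} [AddCommGroup W] [Module k W]

/-- For a function `φ : W → R`, the last `n + 1` components
`(φ (V ^ n x), …, φ (V x), φ x)` of the Witt covector `(…, φ (V ^ 2 x), φ (V x), φ x)`. -/
noncomputable def covector (M : DBT1 p k W) {R : Type*} (φ : W → R) (n : ℕ) (x : W) :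
    TruncatedWittVector p (n + 1) R :=
  TruncatedWittVector.mk p fun i => φ ((⇑M.V)^[n - (i : ℕ)] x)

/-- The functor of points, on commutative `k`-algebras `R`, of the finite group scheme `G` over `k`
with Dieudonné module `W`: `G(R)` is the set of homomorphisms of Dieudonné modules from `W` to the
module `CW(R)` of Witt covectors `a = (…, a₋₂, a₋₁, a₀)`. There `V` is the shift
`(V a)₋ₙ = a₋ₙ₋₁`, `F` is `(F a)₋ₙ = (a₋ₙ) ^ p`, the Teichmüller lift of `c ∈ k` acts by
`([c] a)₋ₙ = c ^ (p ^ (-n)) a₋ₙ`, and the component `(a + b)₀` is the value, for all large `n`, of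
the last component of the sum of the Witt vectors `(a₋ₙ, …, a₀)` and `(b₋ₙ, …, b₀)`.
As a homomorphism commutes with `V`, it is determined by its zeroth component `φ : W → R`, through
`x ↦ (…, φ (V ^ 2 x), φ (V x), φ x)`, and it is this `φ` that represents it here.
The condition on covectors that the `a₋ₙ` with `n` large generate a nilpotent ideal is automatic
for finite-dimensional `W`: `φ (V x) ^ p = φ (F (V x)) = φ 0 = 0`. -/
def points (M : DBT1 p k W) (R : Type*) [CommRing R] [Algebra k R] : Set (W → R) :=
  {φ | (∀ (c : k) (x : W), φ (c • x) = algebraMap k R c * φ x) ∧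
    (∀ x, φ (M.F x) = φ x ^ p) ∧
    ∀ x y, ∀ᶠ n : ℕ in atTop,
      φ (x + y) = (M.covector φ n x + M.covector φ n y).coeff (Fin.last n)}

theorem apply_V_eq_zero (M : DBT1 p k W) {R : Type*} [CommRing R] [Algebra k R] [IsReduced R]
    {φ : W → R} (h0 : ∀ (c : k) (x : W), φ (c • x) = algebraMap k R c * φ x)
    (hF : ∀ x, φ (M.F x) = φ x ^ p) (x : W) : φ (M.V x) = 0 := by
  have h : φ (M.V x) ^ p = 0 := by
    rw [← hF, (M.range_V_eq_ker_F (M.V x)).1 ⟨x, rfl⟩]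
    simpa using h0 0 0
  exact pow_eq_zero_iff (Fact.out : p.Prime).ne_zero |>.1 h

theorem iterate_verschiebung_coeff_lt {R : Type*} [CommRing R] (z : WittVector p R) (n : ℕ) :
    ∀ i < n, ((⇑(WittVector.verschiebung (p := p) (R := R)))^[n] z).coeff i = 0 := by
  induction n with
  | zero => intro i hi; omega
  | succ n ih =>
    intro i hi
    rw [Function.iterate_succ_apply']
    cases i with
    | zero => exact WittVector.verschiebung_coeff_zero _
    | succ i => rw [WittVector.verschiebung_coeff_succ]; exact ih i (by omega)

theorem last_coeff_add (n : ℕ) {R : Type*} [CommRing R] (x y : TruncatedWittVector p (n + 1) R)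
    (hx : ∀ i, i ≠ Fin.last n → x.coeff i = 0) (hy : ∀ i, i ≠ Fin.last n → y.coeff i = 0) :
    (x + y).coeff (Fin.last n) = x.coeff (Fin.last n) + y.coeff (Fin.last n) := by
  have key : ∀ z : TruncatedWittVector p (n + 1) R, (∀ i, i ≠ Fin.last n → z.coeff i = 0) →
      z = WittVector.truncate (n + 1)
        ((⇑WittVector.verschiebung)^[n] (WittVector.teichmuller p (z.coeff (Fin.last n)))) := by
    intro z hz
    ext i
    rw [WittVector.coeff_truncate]
    by_cases hi : i = Fin.last n
    · subst hi
      have := WittVector.iterate_verschiebung_coeff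
        (WittVector.teichmuller p (z.coeff (Fin.last n))) n 0
      simp only [zero_add] at this
      simp [this]
    · have h2 : (i : ℕ) ≠ n := fun h => hi (Fin.ext h)
      rw [hz i hi, iterate_verschiebung_coeff_lt _ _ _ (by have := i.2; omega)]
  have h := fun z : WittVector p R => WittVector.iterate_verschiebung_coeff z n 0
  simp only [zero_add] at h
  conv_lhs => rw [key x hx, key y hy, ← map_add, ← iterate_map_add, WittVector.coeff_truncate,
    Fin.val_last, h, WittVector.add_coeff_zero]
  simp

theorem last_coeff_covector_add (M : DBT1 p k W) {R : Type*} [CommRing R] {φ : W → R}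
    (hV : ∀ x, φ (M.V x) = 0) (n : ℕ) (x y : W) :
    (M.covector φ n x + M.covector φ n y).coeff (Fin.last n) = φ x + φ y := by
  have h : ∀ z : W, ∀ i, i ≠ Fin.last n → (M.covector φ n z).coeff i = 0 := by
    intro z i hi
    obtain ⟨m, hm⟩ : ∃ m, n - (i : ℕ) = m + 1 := by
      have := i.2
      have : (i : ℕ) ≠ n := fun h => hi (Fin.ext h)
      exact ⟨n - i - 1, by omega⟩
    simp [covector, TruncatedWittVector.coeff_mk, hm, Function.iterate_succ_apply', hV]
  rw [last_coeff_add n _ _ (h x) (h y)]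
  simp [covector, TruncatedWittVector.coeff_mk]

/-- The group `G(k)` of `k`-rational points of the group scheme with Dieudonné module `W`. The
covectors attached to a `k`-rational point vanish outside their zeroth component (because `k` is
reduced), so the sum of covectors is the pointwise sum. -/
def rationalPoints (M : DBT1 p k W) : AddSubgroup (W → k) where
  carrier := M.points k
  zero_mem' := by
    refine ⟨by simp, fun x => by simp [(Fact.out : p.Prime).ne_zero], fun x y => ?_⟩
    refine Eventually.of_forall fun n => ?_
    rw [M.last_coeff_covector_add (fun _ => rfl)]
    simp
  add_mem' := by
    rintro φ ψ ⟨h0, hF, ha⟩ ⟨h0', hF', ha'⟩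
    have hV := M.apply_V_eq_zero h0 hF
    have hV' := M.apply_V_eq_zero h0' hF'
    refine ⟨fun c x => by simp [h0, h0', mul_add], fun x => ?_, fun x y => ?_⟩
    · simp [hF, hF', add_pow_char]
    · filter_upwards [ha x y, ha' x y] with n h h'
      rw [M.last_coeff_covector_add hV] at h
      rw [M.last_coeff_covector_add hV'] at h'
      rw [M.last_coeff_covector_add (fun z => by simp [hV, hV'])]
      simp only [Pi.add_apply, h, h']
      ring
  neg_mem' := by
    rintro φ ⟨h0, hF, ha⟩
    have hV := M.apply_V_eq_zero h0 hF
    refine ⟨fun c x => by simp [h0], fun x => ?_, fun x y => ?_⟩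
    · have h : (-φ x) ^ p + φ x ^ p = 0 := by
        rw [← add_pow_char (-φ x) (φ x) p]
        simp [(Fact.out : p.Prime).ne_zero]
      simp only [Pi.neg_apply, hF]
      exact (eq_neg_of_add_eq_zero_left h).symm
    · filter_upwards [ha x y] with n h
      rw [M.last_coeff_covector_add hV] at h
      rw [M.last_coeff_covector_add (fun z => by simp [hV])]
      simp only [Pi.neg_apply, h]
      ring

end DBT1

/-! ### Random principally quasi-polarized modules -/

/-- The standard symplectic form on `k ^ (2 g)`. -/
def stdForm {k : Type*} [Field k] {g : ℕ} (x y : Fin g ⊕ Fin g → k) : k :=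
  dotProduct x ((Matrix.J (Fin g) k).mulVec y)

/-- A principally quasi-polarized `DBT₁` on the standard symplectic space `k ^ (2 g)`. -/
structure PqpDBT1 (p : ℕ) [Fact p.Prime] (k : Type*) [Field k] [CharP k p] [PerfectRing k p]
    (g : ℕ) extends DBT1 p k (Fin g ⊕ Fin g → k) where
  form_F : ∀ x y, stdForm (F x) y = stdForm x (V y) ^ p

theorem stdForm_symplectic {k : Type*} [Field k] {g : ℕ}
    (A : Matrix.symplecticGroup (Fin g) k) (x y : Fin g ⊕ Fin g → k) :
    stdForm (A.1.mulVec x) (A.1.mulVec y) = stdForm x y := by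
  have h := SymplecticGroup.mem_iff'.1 A.2
  simp only [stdForm, Matrix.dotProduct_mulVec, Matrix.vecMul_mulVec]
  rw [Matrix.vecMul_vecMul, h]

namespace PqpDBT1

variable {p : ℕ} [Fact p.Prime] {k : Type*} [Field k] [CharP k p] [PerfectRing k p] {g : ℕ}

theorem inv_mulVec_mulVec (A : Matrix.symplecticGroup (Fin g) k) (x : Fin g ⊕ Fin g → k) :
    (A⁻¹).1.mulVec (A.1.mulVec x) = x := by
  have h : (A⁻¹).1 * A.1 = 1 := congrArg Subtype.val (inv_mul_cancel A)
  rw [Matrix.mulVec_mulVec, h, Matrix.one_mulVec]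

theorem mulVec_inv_mulVec (A : Matrix.symplecticGroup (Fin g) k) (x : Fin g ⊕ Fin g → k) :
    A.1.mulVec ((A⁻¹).1.mulVec x) = x := by
  have h : A.1 * (A⁻¹).1 = 1 := congrArg Subtype.val (mul_inv_cancel A)
  rw [Matrix.mulVec_mulVec, h, Matrix.one_mulVec]

theorem mulVec_eq_zero (A : Matrix.symplecticGroup (Fin g) k) (x : Fin g ⊕ Fin g → k) :
    A.1.mulVec x = 0 ↔ x = 0 := by
  refine ⟨fun h => ?_, fun h => by rw [h, Matrix.mulVec_zero]⟩
  rw [← inv_mulVec_mulVec A x, h, Matrix.mulVec_zero]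

theorem inv_mulVec_eq_zero (A : Matrix.symplecticGroup (Fin g) k) (x : Fin g ⊕ Fin g → k) :
    (A⁻¹).1.mulVec x = 0 ↔ x = 0 :=
  mulVec_eq_zero A⁻¹ x

/-- The principally quasi-polarized `DBT₁` with Frobenius `A F B`, for `A` and `B` in the
symplectic group; its Verschiebung, the adjoint of `A F B`, is `B⁻¹ V A⁻¹`. -/
noncomputable def translate (D : PqpDBT1 p k g) (A B : Matrix.symplecticGroup (Fin g) k) : PqpDBT1 p k g where
  F := (Matrix.mulVecLin A.1).comp (D.F.comp (Matrix.mulVecLin B.1))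
  V := (Matrix.mulVecLin (B⁻¹).1).comp (D.V.comp (Matrix.mulVecLin (A⁻¹).1))
  range_F_eq_ker_V x := by
    simp only [LinearMap.comp_apply, Matrix.mulVecLin_apply]
    rw [inv_mulVec_eq_zero, ← D.range_F_eq_ker_V]
    constructor
    · rintro ⟨y, rfl⟩
      exact ⟨_, by rw [inv_mulVec_mulVec]⟩
    · rintro ⟨y, hy⟩
      refine ⟨(B⁻¹).1.mulVec y, ?_⟩
      rw [mulVec_inv_mulVec, hy, mulVec_inv_mulVec]
  range_V_eq_ker_F x := by
    simp only [LinearMap.comp_apply, Matrix.mulVecLin_apply]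
    rw [mulVec_eq_zero, ← D.range_V_eq_ker_F]
    constructor
    · rintro ⟨y, rfl⟩
      exact ⟨_, by rw [mulVec_inv_mulVec]⟩
    · rintro ⟨y, hy⟩
      refine ⟨A.1.mulVec y, ?_⟩
      rw [inv_mulVec_mulVec, hy, inv_mulVec_mulVec]
  form_F x y := by
    simp only [LinearMap.comp_apply, Matrix.mulVecLin_apply]
    rw [← stdForm_symplectic A⁻¹, inv_mulVec_mulVec, D.form_F, ← stdForm_symplectic B⁻¹,
      inv_mulVec_mulVec]

/-- The standard example: `F (x, y) = (0, σ y)` and `V (x, y) = (σ⁻¹ x, 0)`, the reduction modulo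
`p` of the operators `F (x, y) = (p σ x, σ y)` and `V (x, y) = (σ⁻¹ x, p σ⁻¹ y)`. -/
noncomputable def standard : PqpDBT1 p k g where
  F :=
    { toFun := fun x => Sum.elim (fun _ => 0) fun i => frobeniusEquiv k p (x (Sum.inr i))
      map_add' := fun x y => by ext (i | i) <;> simp
      map_smul' := fun c x => by ext (i | i) <;> simp }
  V :=
    { toFun := fun x => Sum.elim (fun i => (frobeniusEquiv k p).symm (x (Sum.inl i))) fun _ => 0
      map_add' := fun x y => by ext (i | i) <;> simp
      map_smul' := fun c x => by ext (i | i) <;> simp }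
  range_F_eq_ker_V x := by
    constructor
    · rintro ⟨y, rfl⟩
      ext (i | i) <;> simp
    · intro h
      have h0 : ∀ i, x (Sum.inl i) = 0 := fun i => by
        simpa using congrFun h (Sum.inl i)
      refine ⟨fun i => (frobeniusEquiv k p).symm (x i), ?_⟩
      ext (i | i) <;> simp [h0, -frobeniusEquiv_apply]
  range_V_eq_ker_F x := by
    constructor
    · rintro ⟨y, rfl⟩
      ext (i | i) <;> simp
    · intro h
      have h0 : ∀ i, x (Sum.inr i) = 0 := fun i => by
        simpa [-frobeniusEquiv_apply] using congrFun h (Sum.inr i)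
      refine ⟨fun i => frobeniusEquiv k p (x i), ?_⟩
      ext (i | i) <;> simp [h0, -frobeniusEquiv_apply]
  form_F x y := by
    have h : ∀ z : k, z ^ p = frobeniusEquiv k p z := fun z => rfl
    simp only [stdForm, Matrix.J, dotProduct, Matrix.fromBlocks_mulVec]
    rw [h, map_sum]
    simp [Fintype.sum_sum_type, Matrix.neg_mulVec, -frobeniusEquiv_apply]

noncomputable instance : Inhabited (PqpDBT1 p k g) := ⟨standard⟩

/-- The probability that a random principally quasi-polarized `DBT₁` of dimension `2 g` satisfies
`P`: the Frobenius is `A F₀ B`, with `(A, B)` uniformly distributed in the product of two copies of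
the finite group `Sp_{2g}(k)`, and with `F₀` the Frobenius of the base point `D₀`. -/
noncomputable def prob (D₀ : PqpDBT1 p k g) (P : PqpDBT1 p k g → Prop) : ℝ :=
  (Nat.card {h : Matrix.symplecticGroup (Fin g) k × Matrix.symplecticGroup (Fin g) k //
      P (D₀.translate h.1 h.2)} : ℝ) /
    (Nat.card (Matrix.symplecticGroup (Fin g) k × Matrix.symplecticGroup (Fin g) k) : ℝ)

end PqpDBT1

/-!
The symplectic form identifies the rational points of the group scheme of a pqp `DBT₁` with the
fixed points of its Verschiebung (`PqpDBT1.card_rationalPoints`). For the Frobenius `A F₀ B` these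
correspond to the vectors `u` with `V₀ u = C u`, where `C = B A`, and `C` is uniformly distributed
in the symplectic group. So the order of the group is that of the `F_p`-vector space
`X = {u | V₀ u = C u}` for a random `C`.

The distribution of `dim X` is found from its moments, the expected numbers of injections
`F_p ^ m → X`. By Artin's argument (`linearIndependent_of_bot`) an injection is a tuple
`u : Fin m → X` which is independent over `k`; it is then isotropic, as `V₀ u` is. By Witt's theorem
(`exists_symplectic_map_frame`, proved with transvections) the symplectic group is transitive on
isotropic frames, and double counting (`PqpDBT1.card_coincidencePairs`) identifies the moment with
the probability that the image of a random isotropic frame under `V₀` is still independent, i.e.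
that the span of the frame avoids the Lagrangian subspace `ker V₀`. Hence every moment is at most
`1`, and a union bound over the vectors in the span shows that it tends to `1` as `g → ∞`.

The `q`-binomial inversion formula (`hasSum_eulerTerm_mul_prod`) expresses the indicator of
`dim X = d`, and so the probability, as a series in the moments, which is dominated uniformly in `g`
because the moments are at most `1`. In the limit all moments become `1`, and Euler's identity
(`tsum_eulerTerm`) sums the series to the product in the theorem.
-/

/-! ### Transitivity of the symplectic group on isotropic frames -/

section Symplectic

variable {k : Type*} [Field k] {g : ℕ}

/-- The standard symplectic form as a bilinear form. -/
noncomputable def stdBilin (k : Type*) [Field k] (g : ℕ) :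
    LinearMap.BilinForm k (Fin g ⊕ Fin g → k) :=
  Matrix.toBilin' (Matrix.J (Fin g) k)

theorem stdForm_eq_stdBilin (x y : Fin g ⊕ Fin g → k) : stdForm x y = stdBilin k g x y :=
  (Matrix.toBilin'_apply' _ x y).symm

theorem stdBilin_nondegenerate : (stdBilin k g).Nondegenerate :=
  LinearMap.BilinForm.nondegenerate_toBilin'_of_det_ne_zero' _
    (Matrix.isUnit_det_J (Fin g) k).ne_zero

theorem stdBilin_self (x : Fin g ⊕ Fin g → k) : stdBilin k g x x = 0 := by
  rw [← stdForm_eq_stdBilin]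
  simp [stdForm, Matrix.J, dotProduct, Matrix.fromBlocks_mulVec, Fintype.sum_sum_type,
    Matrix.neg_mulVec, mul_comm]

theorem stdBilin_neg (x y : Fin g ⊕ Fin g → k) : -stdBilin k g x y = stdBilin k g y x :=
  LinearMap.IsAlt.neg (B := stdBilin k g) stdBilin_self x y

theorem stdBilin_eq_zero_comm {x y : Fin g ⊕ Fin g → k} :
    stdBilin k g x y = 0 ↔ stdBilin k g y x = 0 := by
  rw [← stdBilin_neg y x, neg_eq_zero]

theorem stdBilin_symplectic (A : Matrix.symplecticGroup (Fin g) k) (x y : Fin g ⊕ Fin g → k) :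
    stdBilin k g (A.1.mulVec x) (A.1.mulVec y) = stdBilin k g x y := by
  simpa only [stdForm_eq_stdBilin] using stdForm_symplectic A x y

/-- Every functional is the pairing with a unique vector. -/
theorem exists_stdBilin_eq (f : Module.Dual k (Fin g ⊕ Fin g → k)) :
    ∃ z, ∀ x, stdBilin k g x z = f x := by
  obtain ⟨z, hz⟩ := ((stdBilin k g).toDual stdBilin_nondegenerate).surjective f
  refine ⟨-z, fun x => ?_⟩
  rw [← hz, LinearMap.BilinForm.toDual_def, map_neg, stdBilin_neg]

theorem stdBilin_right_injective {y z : Fin g ⊕ Fin g → k}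
    (h : ∀ x, stdBilin k g x y = stdBilin k g x z) : y = z := by
  apply ((stdBilin k g).toDual stdBilin_nondegenerate).injective
  refine LinearMap.ext fun x => ?_
  rw [LinearMap.BilinForm.toDual_def, LinearMap.BilinForm.toDual_def, ← stdBilin_neg, h,
    stdBilin_neg]

/-- A subspace equals its double orthogonal: a vector outside `U` is detected by some vector
orthogonal to `U`. -/
theorem exists_orthogonal_ne_zero {U : Submodule k (Fin g ⊕ Fin g → k)} {x : Fin g ⊕ Fin g → k}
    (hx : x ∉ U) : ∃ z, (∀ u ∈ U, stdBilin k g u z = 0) ∧ stdBilin k g x z ≠ 0 := by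
  obtain ⟨f, hf, hU⟩ := Submodule.exists_le_ker_of_notMem hx
  obtain ⟨z, hz⟩ := exists_stdBilin_eq f
  exact ⟨z, fun u hu => by rw [hz]; exact hU hu, by rwa [hz]⟩

theorem finrank_le_of_isotropic (U : Submodule k (Fin g ⊕ Fin g → k))
    (hU : ∀ x ∈ U, ∀ y ∈ U, stdBilin k g x y = 0) : Module.finrank k U ≤ g := by
  have h := LinearMap.BilinForm.finrank_orthogonal (stdBilin_nondegenerate (k := k) (g := g)) U
  have hle : U ≤ (stdBilin k g).orthogonal U := fun x hx y hy => hU y hy x hx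
  have h1 := Submodule.finrank_mono hle
  have h2 : Module.finrank k (Fin g ⊕ Fin g → k) = g + g := by simp
  omega

theorem exists_symplectic_of_isometry
    (f : (Fin g ⊕ Fin g → k) →ₗ[k] (Fin g ⊕ Fin g → k))
    (hf : ∀ x y, stdBilin k g (f x) (f y) = stdBilin k g x y) :
    ∃ A : Matrix.symplecticGroup (Fin g) k, ∀ x, A.1.mulVec x = f x := by
  refine ⟨⟨LinearMap.toMatrix' f, ?_⟩, fun x => LinearMap.toMatrix'_mulVec f x⟩
  rw [SymplecticGroup.mem_iff']
  apply Matrix.toBilin'.injective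
  refine LinearMap.ext fun x => LinearMap.ext fun y => ?_
  have h := hf x y
  rw [← LinearMap.toMatrix'_mulVec f x, ← LinearMap.toMatrix'_mulVec f y] at h
  rw [stdBilin, Matrix.toBilin'_apply', Matrix.toBilin'_apply'] at h
  rw [Matrix.toBilin'_apply', Matrix.toBilin'_apply', ← h, ← Matrix.mulVec_mulVec,
    ← Matrix.mulVec_mulVec, Matrix.dotProduct_mulVec, Matrix.vecMul_transpose]

/-- If `ω (x, z) ≠ 0`, the transvection along `z - x` with the right parameter maps `x` to `z`. It
fixes every vector orthogonal to both. -/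
theorem exists_transvection {x z : Fin g ⊕ Fin g → k} (hxz : stdBilin k g x z ≠ 0) :
    ∃ A : Matrix.symplecticGroup (Fin g) k, A.1.mulVec x = z ∧
      ∀ w, stdBilin k g w x = 0 → stdBilin k g w z = 0 → A.1.mulVec w = w := by
  set v := z - x with hv
  set a := (stdBilin k g z x)⁻¹ with ha
  have hzx : stdBilin k g z x ≠ 0 := fun h => hxz (stdBilin_eq_zero_comm.1 h)
  obtain ⟨A, hA⟩ := exists_symplectic_of_isometry
    (LinearMap.id + a • (stdBilin k g v).smulRight v) (by
      intro x y
      simp only [LinearMap.add_apply, LinearMap.id_apply, LinearMap.smul_apply,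
        LinearMap.smulRight_apply, map_add, map_smul, smul_eq_mul, stdBilin_self v]
      rw [← stdBilin_neg v x]
      ring)
  refine ⟨A, ?_, fun w hwx hwz => ?_⟩
  · rw [hA]
    have h1 : stdBilin k g v x = stdBilin k g z x := by
      simp [hv, stdBilin_self]
    simp only [LinearMap.add_apply, LinearMap.id_apply, LinearMap.smul_apply,
      LinearMap.smulRight_apply, h1, smul_smul, ha, inv_mul_cancel₀ hzx, one_smul]
    exact add_sub_cancel x z
  · rw [hA]
    have h1 : stdBilin k g v w = 0 := by
      rw [stdBilin_eq_zero_comm]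
      simp [hv, hwx, hwz]
    simp [h1]

/-- The orthogonal complement of `U` is not the union of the two proper subspaces on which the
pairings with `x` and with `y` vanish. -/
theorem exists_orthogonal_ne_zero_ne_zero {U : Submodule k (Fin g ⊕ Fin g → k)}
    {x y : Fin g ⊕ Fin g → k} (hx : x ∉ U) (hy : y ∉ U) :
    ∃ z, (∀ u ∈ U, stdBilin k g u z = 0) ∧ stdBilin k g x z ≠ 0 ∧ stdBilin k g y z ≠ 0 := by
  obtain ⟨z, hz, hxz⟩ := exists_orthogonal_ne_zero hx
  obtain ⟨w, hw, hyw⟩ := exists_orthogonal_ne_zero hy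
  by_cases hyz : stdBilin k g y z = 0
  · by_cases hxw : stdBilin k g x w = 0
    · refine ⟨z + w, fun u hu => by simp [hz u hu, hw u hu], ?_, ?_⟩ <;> simpa [hyz, hxw]
    · exact ⟨w, hw, hxw, hyw⟩
  · exact ⟨z, hz, hxz, hyz⟩

/-- Isotropic frames: linearly independent tuples of pairwise orthogonal vectors. -/
structure IsIsotropicFrame {m : ℕ} (u : Fin m → Fin g ⊕ Fin g → k) : Prop where
  linearIndependent : LinearIndependent k u
  isotropic : ∀ i j, stdBilin k g (u i) (u j) = 0

theorem mul_mulVec (A B : Matrix.symplecticGroup (Fin g) k) (x : Fin g ⊕ Fin g → k) :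
    (A * B).1.mulVec x = A.1.mulVec (B.1.mulVec x) := by
  simp [Matrix.mulVec_mulVec]

theorem mulVec_injective (A : Matrix.symplecticGroup (Fin g) k) :
    Function.Injective A.1.mulVec :=
  Function.LeftInverse.injective (g := (A⁻¹).1.mulVec) fun x => by
    have h : (A⁻¹).1 * A.1 = 1 := congrArg Subtype.val (inv_mul_cancel A)
    rw [Matrix.mulVec_mulVec, h, Matrix.one_mulVec]

theorem linearIndependent_mulVec (A : Matrix.symplecticGroup (Fin g) k) {m : ℕ}
    {u : Fin m → Fin g ⊕ Fin g → k} (hu : LinearIndependent k u) :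
    LinearIndependent k fun i => A.1.mulVec (u i) :=
  hu.map' (Matrix.mulVecLin A.1) (LinearMap.ker_eq_bot.2 (mulVec_injective A))

theorem IsIsotropicFrame.mulVec {m : ℕ} {u : Fin m → Fin g ⊕ Fin g → k} (hu : IsIsotropicFrame u)
    (A : Matrix.symplecticGroup (Fin g) k) : IsIsotropicFrame fun i => A.1.mulVec (u i) :=
  ⟨linearIndependent_mulVec A hu.1, fun i j => by rw [stdBilin_symplectic, hu.2]⟩

theorem IsIsotropicFrame.init {m : ℕ} {u : Fin (m + 1) → Fin g ⊕ Fin g → k}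
    (hu : IsIsotropicFrame u) : IsIsotropicFrame (Fin.init u) :=
  ⟨(linearIndependent_finSucc'.1 hu.1).1, fun _ _ => hu.2 _ _⟩

/-- Witt's theorem for isotropic frames. -/
theorem exists_symplectic_map_frame {m : ℕ} {u u' : Fin m → Fin g ⊕ Fin g → k}
    (hu : IsIsotropicFrame u) (hu' : IsIsotropicFrame u') :
    ∃ A : Matrix.symplecticGroup (Fin g) k, ∀ i, A.1.mulVec (u i) = u' i := by
  induction m with
  | zero => exact ⟨1, fun i => i.elim0⟩
  | succ m ih =>
    obtain ⟨A, hA⟩ := ih hu.init hu'.init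
    set v : Fin (m + 1) → Fin g ⊕ Fin g → k := fun i => A.1.mulVec (u i) with hv
    have hvf : IsIsotropicFrame v := hu.mulVec A
    have hinit : Fin.init v = Fin.init u' := funext hA
    have h1 := (linearIndependent_finSucc'.1 hvf.1).2
    have h2 := (linearIndependent_finSucc'.1 hu'.1).2
    rw [hinit] at h1
    -- An intermediate vector `z`, so that `v m` can be moved to `z` and then to `u' m`.
    obtain ⟨z, hz, hvz, huz⟩ := exists_orthogonal_ne_zero_ne_zero h1 h2
    have hz' : ∀ i : Fin m, stdBilin k g (u' i.castSucc) z = 0 := fun i =>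
      hz _ (Submodule.subset_span ⟨i, rfl⟩)
    obtain ⟨T, hT, hTw⟩ := exists_transvection hvz
    obtain ⟨S, hS, hSw⟩ := exists_transvection (fun h => huz (stdBilin_eq_zero_comm.1 h))
    refine ⟨S * T * A, fun i => ?_⟩
    have hmul : (S * T * A).1.mulVec (u i) = S.1.mulVec (T.1.mulVec (v i)) := by
      simp [hv, Matrix.mulVec_mulVec, mul_assoc]
    rw [hmul]
    refine Fin.lastCases ?_ (fun j => ?_) i
    · rw [hT, hS]
    · have h3 : v j.castSucc = u' j.castSucc := hA j
      rw [hTw _ (hvf.2 _ _) (by rw [h3]; exact hz' j), h3, hSw _ (hz' j) (hu'.2 _ _)]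

/-- The symplectic group is transitive on nonzero vectors. -/
theorem exists_symplectic_map {x y : Fin g ⊕ Fin g → k} (hx : x ≠ 0) (hy : y ≠ 0) :
    ∃ A : Matrix.symplecticGroup (Fin g) k, A.1.mulVec x = y := by
  have h : ∀ z : Fin g ⊕ Fin g → k, z ≠ 0 → IsIsotropicFrame fun _ : Fin 1 => z := fun z hz =>
    ⟨LinearIndependent.of_subsingleton 0 hz, fun _ _ => stdBilin_self z⟩
  obtain ⟨A, hA⟩ := exists_symplectic_map_frame (h x hx) (h y hy)
  exact ⟨A, hA 0⟩

theorem exists_isIsotropicFrame {m : ℕ} (hm : m ≤ g) :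
    ∃ u : Fin m → Fin g ⊕ Fin g → k, IsIsotropicFrame u := by
  refine ⟨fun i => Pi.single (Sum.inl (Fin.castLE hm i)) 1, ?_, fun i j => ?_⟩
  · have h := (Pi.basisFun k (Fin g ⊕ Fin g)).linearIndependent.comp
      (fun i : Fin m => Sum.inl (Fin.castLE hm i))
      (Sum.inl_injective.comp (Fin.castLE_injective hm))
    simpa [Function.comp_def] using h
  · rw [stdBilin, Matrix.toBilin'_single]
    simp [Matrix.J]

/-- Counting by orbit and stabilizer: the image of a nonzero vector under a random symplectic matrix
is uniform among the nonzero vectors. -/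
theorem card_symplectic_map_mem {v : Fin g ⊕ Fin g → k} (hv : v ≠ 0) (S : Set (Fin g ⊕ Fin g → k))
    (hS : ∀ w ∈ S, w ≠ 0) :
    Nat.card {A : Matrix.symplecticGroup (Fin g) k // A.1.mulVec v ∈ S} =
      Nat.card S * Nat.card {A : Matrix.symplecticGroup (Fin g) k // A.1.mulVec v = v} := by
  have hQ : ∀ w, ∃ Q : Matrix.symplecticGroup (Fin g) k, w ∈ S → Q.1.mulVec v = w := fun w => by
    by_cases hw : w ∈ S
    · obtain ⟨Q, hQ⟩ := exists_symplectic_map hv (hS w hw)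
      exact ⟨Q, fun _ => hQ⟩
    · exact ⟨1, fun h => absurd h hw⟩
  choose Q hQ using hQ
  have key : ∀ w ∈ S, ∀ A : Matrix.symplecticGroup (Fin g) k, A.1.mulVec v = v →
      (Q w * A).1.mulVec v = w := fun w hw A hA => by rw [mul_mulVec, hA, hQ w hw]
  rw [← Nat.card_prod]
  refine Nat.card_congr
    { toFun := fun A => (⟨_, A.2⟩, ⟨(Q (A.1.1.mulVec v))⁻¹ * A.1, ?_⟩)
      invFun := fun x => ⟨Q x.1 * x.2.1, (key _ x.1.2 _ x.2.2).symm ▸ x.1.2⟩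
      left_inv := fun A => Subtype.ext (mul_inv_cancel_left _ _)
      right_inv := fun x => Prod.ext (Subtype.ext (key _ x.1.2 _ x.2.2)) (Subtype.ext ?_) }
  · have h := PqpDBT1.inv_mulVec_mulVec (Q (A.1.1.mulVec v)) v
    rwa [hQ _ A.2, ← mul_mulVec] at h
  · change (Q ((Q x.1 * x.2.1).1.mulVec v))⁻¹ * (Q x.1 * x.2.1) = x.2.1
    rw [key _ x.1.2 _ x.2.2, inv_mul_cancel_left]

end Symplectic

/-! ### Rational points as coincidences of Verschiebung and a symplectic map -/

section Points

variable {p : ℕ} [Fact p.Prime] {k : Type*} [Field k] [CharP k p] [PerfectRing k p] {g : ℕ}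

/-- Over `k` itself, which is reduced, the sum of covectors in the definition of the points is the
pointwise sum. -/
theorem DBT1.mem_points_iff {W : Type*} [AddCommGroup W] [Module k W] (M : DBT1 p k W)
    (φ : W → k) : φ ∈ M.points k ↔ (∀ (c : k) (x : W), φ (c • x) = c * φ x) ∧
      (∀ x, φ (M.F x) = φ x ^ p) ∧ ∀ x y, φ (x + y) = φ x + φ y := by
  refine and_congr_right fun h0 => and_congr_right fun hF => forall₂_congr fun x y => ?_
  simp only [M.last_coeff_covector_add (M.apply_V_eq_zero h0 hF), eventually_const]

namespace PqpDBT1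

theorem stdBilin_F (D : PqpDBT1 p k g) (x y : Fin g ⊕ Fin g → k) :
    stdBilin k g (D.F x) y = stdBilin k g x (D.V y) ^ p := by
  simpa only [stdForm_eq_stdBilin] using D.form_F x y

/-- The symplectic form identifies the rational points with the fixed points of `V`. -/
theorem card_rationalPoints (D : PqpDBT1 p k g) :
    Nat.card D.rationalPoints = Nat.card {w : Fin g ⊕ Fin g → k // D.V w = w} := by
  symm
  refine Nat.card_congr (Equiv.ofBijective
    (fun w => ⟨fun x => stdBilin k g x w.1, (D.mem_points_iff _).2 ⟨by simp, ?_, by simp⟩⟩)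
    ⟨?_, ?_⟩)
  · intro x
    rw [D.stdBilin_F, w.2]
  · intro w w' h
    exact Subtype.ext (stdBilin_right_injective fun x => congrFun (congrArg Subtype.val h) x)
  · rintro ⟨φ, hφ⟩
    obtain ⟨h0, hF, ha⟩ := (D.mem_points_iff φ).1 hφ
    obtain ⟨w, hw⟩ := exists_stdBilin_eq
      ({ toFun := φ, map_add' := ha, map_smul' := h0 } : Module.Dual k (Fin g ⊕ Fin g → k))
    replace hw : ∀ x, stdBilin k g x w = φ x := hw
    refine ⟨⟨w, stdBilin_right_injective fun x => ?_⟩, Subtype.ext (funext hw)⟩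
    apply frobenius_inj k p
    rw [frobenius_def, frobenius_def, ← D.stdBilin_F, hw, hF, hw]

/-- The vectors on which the Verschiebung of `D` agrees with `C`. -/
def coincidences (D : PqpDBT1 p k g) (C : Matrix.symplecticGroup (Fin g) k) :
    Set (Fin g ⊕ Fin g → k) :=
  {u | D.V u = C.1.mulVec u}

theorem card_rationalPoints_translate (D : PqpDBT1 p k g)
    (A B : Matrix.symplecticGroup (Fin g) k) :
    Nat.card (D.translate A B).rationalPoints = Nat.card (D.coincidences (B * A)) := by
  rw [card_rationalPoints]
  symm
  have hV : ∀ w, (D.translate A B).V w = (B⁻¹).1.mulVec (D.V ((A⁻¹).1.mulVec w)) := fun w => rfl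
  refine Nat.card_congr
    { toFun := fun u => ⟨A.1.mulVec u.1, ?_⟩
      invFun := fun w => ⟨(A⁻¹).1.mulVec w.1, ?_⟩
      left_inv := fun u => Subtype.ext (inv_mulVec_mulVec A u.1)
      right_inv := fun w => Subtype.ext (mulVec_inv_mulVec A w.1) }
  · have hu : D.V u.1 = (B * A).1.mulVec u.1 := u.2
    rw [hV, inv_mulVec_mulVec, hu, mul_mulVec, inv_mulVec_mulVec]
  · have hw := w.2
    rw [hV] at hw
    change D.V _ = _
    rw [mul_mulVec, mulVec_inv_mulVec, ← hw, mulVec_inv_mulVec, hw]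

variable [Finite k]

/-- The product `C = B A` of two independent uniform elements is uniform, so that a random `DBT₁`
may be replaced by a random symplectic matrix. -/
theorem prob_card_rationalPoints (D : PqpDBT1 p k g) (n : ℕ) :
    (D.prob fun D' => Nat.card D'.rationalPoints = n) =
      (Nat.card {C : Matrix.symplecticGroup (Fin g) k // Nat.card (D.coincidences C) = n} : ℝ) /
        Nat.card (Matrix.symplecticGroup (Fin g) k) := by
  have e : {h : Matrix.symplecticGroup (Fin g) k × Matrix.symplecticGroup (Fin g) k //
      Nat.card (D.translate h.1 h.2).rationalPoints = n} ≃
      Matrix.symplecticGroup (Fin g) k ×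
        {C : Matrix.symplecticGroup (Fin g) k // Nat.card (D.coincidences C) = n} :=
    { toFun := fun h => ⟨h.1.1, h.1.2 * h.1.1, by
        rw [← card_rationalPoints_translate]; exact h.2⟩
      invFun := fun c => ⟨(c.1, c.2.1 * c.1⁻¹), by
        rw [card_rationalPoints_translate, inv_mul_cancel_right]; exact c.2.2⟩
      left_inv := fun h => Subtype.ext (by simp)
      right_inv := fun c => by ext <;> simp }
  have h0 : (Nat.card (Matrix.symplecticGroup (Fin g) k) : ℝ) ≠ 0 :=
    Nat.cast_ne_zero.2 Nat.card_pos.ne'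
  rw [prob, Nat.card_congr e, Nat.card_prod, Nat.card_prod]
  push_cast
  rw [mul_div_mul_left _ _ h0]

end PqpDBT1

end Points

/-! ### Moments of the number of coincidences -/

section Moments

variable {p : ℕ} [Fact p.Prime] {k : Type*} [Field k] [CharP k p] [Finite k] {g : ℕ}

namespace PqpDBT1

/-- The vectors where `V` and `C` agree form a vector space over the prime field. -/
def coincidenceSpace (D : PqpDBT1 p k g) (C : Matrix.symplecticGroup (Fin g) k) :
    Submodule (⊥ : Subfield k) (Fin g ⊕ Fin g → k) where
  carrier := D.coincidences C
  zero_mem' := by simp [coincidences]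
  add_mem' {u v} hu hv := by
    rw [coincidences, Set.mem_ofPred_eq] at hu hv ⊢
    rw [map_add, hu, hv, Matrix.mulVec_add]
  smul_mem' c u hu := by
    have hc : (frobeniusEquiv k p).symm (c : k) = c := by
      rw [RingEquiv.symm_apply_eq, frobeniusEquiv_apply, frobenius_def]
      exact ((Subfield.mem_bot_iff_pow_eq_self k p).1 c.2).symm
    rw [coincidences, Set.mem_ofPred_eq] at hu ⊢
    change D.V ((c : k) • u) = C.1.mulVec ((c : k) • u)
    rw [map_smulₛₗ, hu, Matrix.mulVec_smul]
    simp [hc]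

/-- Coincidences that are independent over the prime field are independent over `k`: if one of them
is a combination of independent others, then applying `V` shows that the coefficients are fixed by
Frobenius. -/
theorem linearIndependent_of_bot (D : PqpDBT1 p k g) (C : Matrix.symplecticGroup (Fin g) k)
    {m : ℕ} {u : Fin m → Fin g ⊕ Fin g → k} (hu : ∀ i, u i ∈ D.coincidences C)
    (h : LinearIndependent (⊥ : Subfield k) u) : LinearIndependent k u := by
  induction m with
  | zero => exact linearIndependent_empty_type
  | succ m ih =>
    rw [linearIndependent_finSucc'] at h ⊢
    have hk := ih (fun i => hu i.castSucc) h.1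
    refine ⟨hk, fun hmem => h.2 ?_⟩
    obtain ⟨c, hc⟩ := (Submodule.mem_span_range_iff_exists_fun k).1 hmem
    have h1 : D.V (u (Fin.last m)) = C.1.mulVec (u (Fin.last m)) := hu _
    have h2 : ∀ i, D.V (Fin.init u i) = C.1.mulVec (Fin.init u i) := fun i => hu _
    rw [← hc, map_sum, Matrix.mulVec_sum] at h1
    simp only [map_smulₛₗ, h2, Matrix.mulVec_smul] at h1
    have h3 := (Fintype.linearIndependent_iff.1 (linearIndependent_mulVec C hk))
      (fun i => (frobeniusEquiv k p).symm (c i) - c i) (by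
        simp only [sub_smul, Finset.sum_sub_distrib, sub_eq_zero]
        exact h1)
    have h4 : ∀ i, c i ∈ (⊥ : Subfield k) := fun i => by
      have h5 := sub_eq_zero.1 (h3 i)
      rw [RingEquiv.symm_apply_eq, frobeniusEquiv_apply, frobenius_def] at h5
      exact (Subfield.mem_bot_iff_pow_eq_self k p).2 h5.symm
    exact (Submodule.mem_span_range_iff_exists_fun _).2 ⟨fun i => ⟨c i, h4 i⟩, hc⟩

theorem exists_card_coincidences (D : PqpDBT1 p k g) (C : Matrix.symplecticGroup (Fin g) k) :
    ∃ n : ℕ, Nat.card (D.coincidences C) = p ^ n := by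
  have h := Module.natCard_eq_pow_finrank (K := (⊥ : Subfield k)) (V := D.coincidenceSpace C)
  rw [Subfield.card_bot k p] at h
  exact ⟨_, h⟩

/-- The tuples of coincidences independent over `k` are the injective linear maps from `F_p ^ m` to
the space of coincidences. -/
theorem card_linearIndependent_coincidences (D : PqpDBT1 p k g)
    (C : Matrix.symplecticGroup (Fin g) k) (m : ℕ) :
    (Nat.card {u : Fin m → Fin g ⊕ Fin g → k //
      LinearIndependent k u ∧ ∀ i, u i ∈ D.coincidences C} : ℝ) =
      ∏ j ∈ Finset.range m, ((Nat.card (D.coincidences C) : ℝ) - (p : ℝ) ^ j) := by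
  let X := D.coincidenceSpace C
  let _ : Fintype (⊥ : Subfield k) := Fintype.ofFinite _
  have hcard : Fintype.card (⊥ : Subfield k) = p := by
    rw [← Nat.card_eq_fintype_card, Subfield.card_bot k p]
  have hX : Nat.card (D.coincidences C) = p ^ Module.finrank (⊥ : Subfield k) X := by
    have := Module.natCard_eq_pow_finrank (K := (⊥ : Subfield k)) (V := X)
    rwa [Subfield.card_bot k p] at this
  have e : {u : Fin m → Fin g ⊕ Fin g → k //
      LinearIndependent k u ∧ ∀ i, u i ∈ D.coincidences C} ≃
      {u : Fin m → X // LinearIndependent (⊥ : Subfield k) u} :=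
    { toFun := fun u => ⟨fun i => ⟨u.1 i, u.2.2 i⟩, by
        have h := u.2.1.restrict_scalars (R := (⊥ : Subfield k)) (by
          intro a b hab
          simpa [Subfield.smul_def] using hab)
        exact LinearIndependent.of_comp X.subtype h⟩
      invFun := fun u => ⟨fun i => (u.1 i).1,
        D.linearIndependent_of_bot C (fun i => (u.1 i).2)
          (u.2.map' X.subtype (Submodule.ker_subtype X)), fun i => (u.1 i).2⟩
      left_inv := fun u => rfl
      right_inv := fun u => rfl }
  rw [Nat.card_congr e, hX]
  rcases le_or_gt m (Module.finrank (⊥ : Subfield k) X) with hm | hm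
  · rw [card_linearIndependent hm, hcard, Finset.prod_range, Nat.cast_prod]
    refine Finset.prod_congr rfl fun j _ => ?_
    rw [Nat.cast_sub (Nat.pow_le_pow_right (Fact.out : p.Prime).pos (by omega))]
    push_cast
    rfl
  · have hempty : IsEmpty {u : Fin m → X // LinearIndependent (⊥ : Subfield k) u} :=
      ⟨fun u => by
        have := u.2.fintype_card_le_finrank
        rw [Fintype.card_fin] at this
        omega⟩
    rw [Nat.card_of_isEmpty, Finset.prod_eq_zero (Finset.mem_range.2 hm)] <;> simp

theorem stdBilin_V_V (D : PqpDBT1 p k g) (x y : Fin g ⊕ Fin g → k) :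
    stdBilin k g (D.V x) (D.V y) = 0 := by
  have h := D.stdBilin_F (D.V x) y
  rw [(D.range_V_eq_ker_F _).1 ⟨x, rfl⟩, map_zero, LinearMap.zero_apply] at h
  exact eq_zero_of_pow_eq_zero h.symm

/-- The pairs of a symplectic matrix `C` and a `k`-independent `m`-tuple on which `V` and `C`
agree. -/
def coincidencePairs (D : PqpDBT1 p k g) (m : ℕ) :
    Set (Matrix.symplecticGroup (Fin g) k × (Fin m → Fin g ⊕ Fin g → k)) :=
  {x | LinearIndependent k x.2 ∧ ∀ i, x.2 i ∈ D.coincidences x.1}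

theorem isIsotropicFrame_of_mem_coincidencePairs (D : PqpDBT1 p k g) {m : ℕ}
    {x : Matrix.symplecticGroup (Fin g) k × (Fin m → Fin g ⊕ Fin g → k)}
    (hx : x ∈ D.coincidencePairs m) : IsIsotropicFrame fun i => D.V (x.2 i) := by
  refine ⟨?_, fun i j => D.stdBilin_V_V _ _⟩
  have h : (fun i => D.V (x.2 i)) = fun i => x.1.1.mulVec (x.2 i) := funext hx.2
  rw [h]
  exact linearIndependent_mulVec _ hx.1

/-- Fix an isotropic frame `e`, and for each tuple `u` whose image under `V` is a frame choose
`Q u` in the symplectic group with `Q u e = V u`. Then `A` corresponds to the pair of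
`C = Q (A e) A⁻¹` and `u = A e`. -/
theorem card_coincidencePairs (D : PqpDBT1 p k g) {m : ℕ} {e : Fin m → Fin g ⊕ Fin g → k}
    (he : IsIsotropicFrame e) :
    Nat.card (D.coincidencePairs m) = Nat.card {A : Matrix.symplecticGroup (Fin g) k //
      LinearIndependent k fun i => D.V (A.1.mulVec (e i))} := by
  have hQ : ∀ u : Fin m → Fin g ⊕ Fin g → k, ∃ Q : Matrix.symplecticGroup (Fin g) k,
      (LinearIndependent k fun i => D.V (u i)) → ∀ i, Q.1.mulVec (e i) = D.V (u i) := by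
    intro u
    by_cases h : LinearIndependent k fun i => D.V (u i)
    · obtain ⟨Q, hQ⟩ := exists_symplectic_map_frame he ⟨h, fun i j => D.stdBilin_V_V _ _⟩
      exact ⟨Q, fun _ => hQ⟩
    · exact ⟨1, fun h' => absurd h' h⟩
  choose Q hQ using hQ
  have key : ∀ x ∈ D.coincidencePairs m, (fun i => (x.1⁻¹ * Q x.2).1.mulVec (e i)) = x.2 := by
    intro x hx
    funext i
    have h : D.V (x.2 i) = x.1.1.mulVec (x.2 i) := hx.2 i
    rw [mul_mulVec, hQ _ (D.isIsotropicFrame_of_mem_coincidencePairs hx).1, h, inv_mulVec_mulVec]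
  refine Nat.card_congr
    { toFun := fun x => ⟨x.1.1⁻¹ * Q x.1.2, ?_⟩
      invFun := fun A => ⟨(Q (fun i => A.1.1.mulVec (e i)) * A.1⁻¹, fun i => A.1.1.mulVec (e i)),
        linearIndependent_mulVec _ he.1, fun i => ?_⟩
      left_inv := fun x => ?_
      right_inv := fun A => ?_ }
  · have h := key x.1 x.2
    have h' := fun i => congrFun h i
    simp only [h']
    exact (D.isIsotropicFrame_of_mem_coincidencePairs x.2).1
  · change D.V _ = _
    rw [mul_mulVec, inv_mulVec_mulVec, hQ _ A.2]
  · have h := key x.1 x.2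
    refine Subtype.ext (Prod.ext ?_ h)
    change Q (fun i => (x.1.1⁻¹ * Q x.1.2).1.mulVec (e i)) * (x.1.1⁻¹ * Q x.1.2)⁻¹ = x.1.1
    rw [h]
    group
  · refine Subtype.ext ?_
    simp

/-- If there is a pair at all, then there is an isotropic frame and `card_coincidencePairs` applies;
otherwise (for `m > g`) the count is zero. -/
theorem card_coincidencePairs_le (D : PqpDBT1 p k g) (m : ℕ) :
    Nat.card (D.coincidencePairs m) ≤ Nat.card (Matrix.symplecticGroup (Fin g) k) := by
  rcases isEmpty_or_nonempty (D.coincidencePairs m) with h | ⟨⟨x, hx⟩⟩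
  · simp
  · rw [D.card_coincidencePairs (D.isIsotropicFrame_of_mem_coincidencePairs hx)]
    exact Finite.card_subtype_le _

/-- The kernel of `V`, being the image of `F`, is isotropic. -/
theorem card_ker_V_le (D : PqpDBT1 p k g) : Nat.card (LinearMap.ker D.V) ≤ Nat.card k ^ g := by
  rw [Module.natCard_eq_pow_finrank (K := k)]
  refine Nat.pow_le_pow_right Nat.card_pos (finrank_le_of_isotropic _ fun x hx y hy => ?_)
  obtain ⟨z, rfl⟩ := (D.range_F_eq_ker_V x).2 hx
  rw [D.stdBilin_F, LinearMap.mem_ker.1 hy, map_zero, zero_pow (Fact.out : p.Prime).ne_zero]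

/-- A random symplectic matrix maps a given nonzero vector into the Lagrangian subspace `ker V` with
probability at most `q ^ (-g)`. -/
theorem card_map_mem_ker_V (D : PqpDBT1 p k g) {v : Fin g ⊕ Fin g → k} (hv : v ≠ 0) :
    Nat.card {A : Matrix.symplecticGroup (Fin g) k // D.V (A.1.mulVec v) = 0} * Nat.card k ^ g ≤
      Nat.card (Matrix.symplecticGroup (Fin g) k) := by
  have h0 : ∀ A : Matrix.symplecticGroup (Fin g) k, A.1.mulVec v ≠ 0 := fun A h =>
    hv ((mulVec_eq_zero A v).1 h)
  have h1 := card_symplectic_map_mem hv ((LinearMap.ker D.V : Set (Fin g ⊕ Fin g → k)) \ {0})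
    fun w hw => hw.2
  have h2 := card_symplectic_map_mem hv (Set.univ \ {0}) fun w hw => hw.2
  simp only [Set.mem_sdiff, SetLike.mem_coe, LinearMap.mem_ker, Set.mem_singleton_iff, h0,
    not_false_eq_true, and_true, Set.mem_univ, Nat.card_coe_set_eq] at h1 h2
  rw [Nat.card_congr (Equiv.subtypeUnivEquiv fun _ => trivial)] at h2
  rw [h1, h2, mul_right_comm]
  refine Nat.mul_le_mul_right _ ?_
  have h3 := Set.ncard_sdiff_singleton_add_one (Set.mem_univ (0 : Fin g ⊕ Fin g → k))
  have h4 := Set.ncard_sdiff_singleton_add_one (LinearMap.ker D.V).zero_mem (Set.toFinite _)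
  have h5 := D.card_ker_V_le
  have h6 : (Set.univ : Set (Fin g ⊕ Fin g → k)).ncard = Nat.card k ^ g * Nat.card k ^ g := by
    rw [Set.ncard_univ, Nat.card_fun]
    simp [pow_add]
  have hq : 1 ≤ Nat.card k ^ g := Nat.one_le_pow _ _ Nat.card_pos
  rw [← SetLike.coe_sort_coe, Nat.card_coe_set_eq, ← h4] at h5
  rw [h6] at h3
  nlinarith

/-- For `m ≤ g`, the image under a random symplectic matrix of a fixed isotropic frame `e` stays
independent after applying `V`, unless one of the fewer than `q ^ m` nonzero combinations of `e`
falls into `ker V`. -/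
theorem le_card_coincidencePairs (D : PqpDBT1 p k g) {m : ℕ} (hm : m ≤ g) :
    Nat.card (Matrix.symplecticGroup (Fin g) k) * Nat.card k ^ g ≤
      Nat.card (D.coincidencePairs m) * Nat.card k ^ g +
        Nat.card k ^ m * Nat.card (Matrix.symplecticGroup (Fin g) k) := by
  classical
  obtain ⟨e, he⟩ := exists_isIsotropicFrame (k := k) hm
  let _ : Fintype (Matrix.symplecticGroup (Fin g) k) := Fintype.ofFinite _
  let _ : Fintype k := Fintype.ofFinite _
  set P : Matrix.symplecticGroup (Fin g) k → Prop := fun A =>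
    LinearIndependent k fun i => D.V (A.1.mulVec (e i)) with hP
  have hbad : Finset.univ.filter (fun A => ¬ P A) ⊆
      (Finset.univ.filter fun c : Fin m → k => c ≠ 0).biUnion fun c =>
        Finset.univ.filter fun A : Matrix.symplecticGroup (Fin g) k =>
          D.V (A.1.mulVec (∑ i, c i • e i)) = 0 := by
    intro A hA
    rw [Finset.mem_filter, hP, Fintype.not_linearIndependent_iff] at hA
    obtain ⟨-, b, hb, i, hi⟩ := hA
    simp only [Finset.mem_biUnion, Finset.mem_filter, Finset.mem_univ, true_and]
    -- `V` is inverse-Frobenius-semilinear: it takes the combination with coefficients `b i ^ p` to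
    -- the one with coefficients `b i`.
    refine ⟨fun i => frobeniusEquiv k p (b i), fun h => hi ?_, ?_⟩
    · exact (map_eq_zero_iff _ (frobeniusEquiv k p).injective).1 (congrFun h i)
    · rw [Matrix.mulVec_sum, map_sum, ← hb]
      refine Finset.sum_congr rfl fun j _ => ?_
      rw [Matrix.mulVec_smul, map_smulₛₗ]
      simp
  have hcount : (Finset.univ.filter fun A => ¬ P A).card * Nat.card k ^ g ≤
      Nat.card k ^ m * Nat.card (Matrix.symplecticGroup (Fin g) k) := by
    calc _ ≤ (∑ c ∈ Finset.univ.filter (fun c : Fin m → k => c ≠ 0),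
          (Finset.univ.filter fun A : Matrix.symplecticGroup (Fin g) k =>
            D.V (A.1.mulVec (∑ i, c i • e i)) = 0).card) * Nat.card k ^ g :=
          Nat.mul_le_mul_right _ ((Finset.card_le_card hbad).trans Finset.card_biUnion_le)
      _ ≤ ∑ c ∈ Finset.univ.filter (fun c : Fin m → k => c ≠ 0),
          Nat.card (Matrix.symplecticGroup (Fin g) k) := by
          rw [Finset.sum_mul]
          refine Finset.sum_le_sum fun c hc => ?_
          rw [← Fintype.card_subtype, ← Nat.card_eq_fintype_card]
          refine D.card_map_mem_ker_V fun h => (Finset.mem_filter.1 hc).2 ?_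
          exact funext (Fintype.linearIndependent_iff.1 he.1 c h)
      _ ≤ _ := by
          rw [Finset.sum_const, smul_eq_mul]
          refine Nat.mul_le_mul_right _ ((Finset.card_le_univ _).trans ?_)
          simp
  have hgood : Nat.card (D.coincidencePairs m) = (Finset.univ.filter P).card := by
    rw [D.card_coincidencePairs he, ← Fintype.card_subtype, ← Nat.card_eq_fintype_card]
  have hsplit := Finset.card_filter_add_card_filter_not
    (s := (Finset.univ : Finset (Matrix.symplecticGroup (Fin g) k))) P
  rw [Finset.card_univ, ← Nat.card_eq_fintype_card, ← hgood] at hsplit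
  refine le_trans (le_of_eq ?_) (Nat.add_le_add_left hcount _)
  rw [← add_mul, ← hsplit]

theorem card_coincidencePairs_eq_sum (D : PqpDBT1 p k g)
    [Fintype (Matrix.symplecticGroup (Fin g) k)] (m : ℕ) :
    (Nat.card (D.coincidencePairs m) : ℝ) = ∑ C : Matrix.symplecticGroup (Fin g) k,
      ∏ j ∈ Finset.range m, ((Nat.card (D.coincidences C) : ℝ) - (p : ℝ) ^ j) := by
  have e : D.coincidencePairs m ≃ Σ C : Matrix.symplecticGroup (Fin g) k,
      {u : Fin m → Fin g ⊕ Fin g → k //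
        LinearIndependent k u ∧ ∀ i, u i ∈ D.coincidences C} :=
    Equiv.subtypeProdEquivSigmaSubtype fun C (u : Fin m → Fin g ⊕ Fin g → k) =>
      LinearIndependent k u ∧ ∀ i, u i ∈ D.coincidences C
  rw [Nat.card_congr e, Nat.card_sigma, Nat.cast_sum]
  exact Finset.sum_congr rfl fun C _ => D.card_linearIndependent_coincidences C m

end PqpDBT1

end Moments

/-! ### Inversion of the moments and Euler's product -/

section Euler

/-- The product `(x - 1) (x ^ 2 - 1) ⋯ (x ^ n - 1)`. -/
noncomputable def qProd (x : ℝ) (n : ℕ) : ℝ :=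
  ∏ j ∈ Finset.range n, (x ^ (j + 1) - 1)

theorem qProd_succ (x : ℝ) (n : ℕ) : qProd x (n + 1) = qProd x n * (x ^ (n + 1) - 1) :=
  Finset.prod_range_succ _ _

theorem qProd_pos {x : ℝ} (hx : 1 < x) (n : ℕ) : 0 < qProd x n :=
  Finset.prod_pos fun j _ => sub_pos.2 (one_lt_pow₀ hx j.succ_ne_zero)

/-- A partial sum of the `q`-binomial series telescopes. -/
theorem sum_range_alternating_qBinomial {x : ℝ} (hx : 1 < x) (y : ℝ) (N : ℕ) :
    ∑ i ∈ Finset.range (N + 1), (-1) ^ i * (∏ j ∈ Finset.range i, (y - x ^ j)) / qProd x i =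
      (-1) ^ N * (∏ j ∈ Finset.range N, (y - x ^ (j + 1))) / qProd x N := by
  induction N with
  | zero => simp
  | succ N ih =>
    have h1 := (qProd_pos hx N).ne'
    have h2 : x ^ (N + 1) - 1 ≠ 0 := (sub_pos.2 (one_lt_pow₀ hx N.succ_ne_zero)).ne'
    rw [Finset.sum_range_succ, ih, Finset.prod_range_succ' (fun j => y - x ^ j),
      Finset.prod_range_succ (fun j => y - x ^ (j + 1)), qProd_succ]
    field_simp
    ring

/-- The terms of Euler's series for `∏ j, (1 - x ^ (-(d + 1 + j)))`. -/
noncomputable def eulerTerm (x : ℝ) (d i : ℕ) : ℝ :=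
  (-1) ^ i * (x ^ (d * i))⁻¹ / qProd x i

/-- Inversion of the moments: an alternating sum over `i` of the numbers of injective linear maps
from a space of dimension `d + i` to one of dimension `n` (over a field of `x` elements) detects
whether `n = d`. -/
theorem hasSum_eulerTerm_mul_prod {x : ℝ} (hx : 1 < x) (d n : ℕ) :
    HasSum (fun i => eulerTerm x d i / (∏ j ∈ Finset.range d, (x ^ d - x ^ j)) *
      ∏ j ∈ Finset.range (d + i), (x ^ n - x ^ j)) (if n = d then 1 else 0) := by
  have hx0 : x ≠ 0 := by positivity
  have hzero : ∀ a m : ℕ, a < m → ∏ j ∈ Finset.range m, (x ^ a - x ^ j) = 0 := fun a m h =>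
    Finset.prod_eq_zero (Finset.mem_range.2 h) (sub_self _)
  rcases lt_or_ge n d with h | h
  · rw [if_neg h.ne]
    convert hasSum_zero using 2 with i
    rw [hzero n (d + i) (by omega), mul_zero]
  obtain ⟨e, rfl⟩ := Nat.exists_eq_add_of_le h
  -- With `n = d + e`, all but a constant factor depends on `e` alone.
  have hterm : ∀ i, eulerTerm x d i / (∏ j ∈ Finset.range d, (x ^ d - x ^ j)) *
      ∏ j ∈ Finset.range (d + i), (x ^ (d + e) - x ^ j) =
      (∏ j ∈ Finset.range d, (x ^ (d + e) - x ^ j)) / (∏ j ∈ Finset.range d, (x ^ d - x ^ j)) *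
        ((-1) ^ i * (∏ j ∈ Finset.range i, (x ^ e - x ^ j)) / qProd x i) := by
    intro i
    have h1 : ∏ j ∈ Finset.range i, (x ^ (d + e) - x ^ (d + j)) =
        x ^ (d * i) * ∏ j ∈ Finset.range i, (x ^ e - x ^ j) := by
      simp only [pow_add, ← mul_sub, Finset.prod_mul_distrib, Finset.prod_const, Finset.card_range,
        pow_mul]
    rw [Finset.prod_range_add, h1, eulerTerm]
    field_simp
  simp only [hterm]
  have hsum := hasSum_sum_of_ne_finset_zero (L := SummationFilter.unconditional ℕ)
    (s := Finset.range (e + 1))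
    (f := fun i => (-1) ^ i * (∏ j ∈ Finset.range i, (x ^ e - x ^ j)) / qProd x i) (fun i hi => by
      rw [hzero e i (by simpa using hi)]
      simp)
  rw [sum_range_alternating_qBinomial hx] at hsum
  have hmain := hsum.mul_left ((∏ j ∈ Finset.range d, (x ^ (d + e) - x ^ j)) /
    (∏ j ∈ Finset.range d, (x ^ d - x ^ j)))
  rcases e with _ | e
  · have h2 : ∏ j ∈ Finset.range d, (x ^ d - x ^ j) ≠ 0 := Finset.prod_ne_zero_iff.2 fun j hj =>
      (sub_pos.2 (pow_lt_pow_right₀ hx (Finset.mem_range.1 hj))).ne'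
    simpa [h2, qProd] using hmain
  · rw [Finset.prod_eq_zero (Finset.mem_range.2 e.lt_succ_self) (sub_self _), mul_zero, zero_div,
      mul_zero] at hmain
    rwa [if_neg (by omega)]

theorem summable_inv_qProd {x : ℝ} (hx : 1 < x) : Summable fun i => (qProd x i)⁻¹ := by
  refine summable_of_ratio_test_tendsto_lt_one zero_lt_one
    (Eventually.of_forall fun i => (inv_pos.2 (qProd_pos hx i)).ne') ?_
  have h : Tendsto (fun i : ℕ => (x ^ (i + 1) - 1)⁻¹) atTop (𝓝 0) :=
    tendsto_inv_atTop_zero.comp (tendsto_atTop_add_const_right _ (-1)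
      ((tendsto_pow_atTop_atTop_of_one_lt hx).comp (tendsto_add_atTop_nat 1)))
  refine h.congr fun i => ?_
  rw [Real.norm_of_nonneg (inv_pos.2 (qProd_pos hx _)).le,
    Real.norm_of_nonneg (inv_pos.2 (qProd_pos hx _)).le, qProd_succ]
  have h1 := (qProd_pos hx i).ne'
  have h2 : x ^ (i + 1) - 1 ≠ 0 := (sub_pos.2 (one_lt_pow₀ hx i.succ_ne_zero)).ne'
  field_simp

theorem norm_eulerTerm_le {x : ℝ} (hx : 1 < x) (d i : ℕ) :
    ‖eulerTerm x d i‖ ≤ (qProd x i)⁻¹ := by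
  rw [eulerTerm, norm_div, norm_mul, norm_pow, norm_neg, norm_one, one_pow, one_mul,
    Real.norm_of_nonneg (qProd_pos hx i).le, Real.norm_of_nonneg (by positivity), div_eq_mul_inv]
  exact mul_le_of_le_one_left (inv_pos.2 (qProd_pos hx i)).le
    (inv_le_one_of_one_le₀ (one_le_pow₀ hx.le))

theorem summable_eulerTerm {x : ℝ} (hx : 1 < x) (d : ℕ) : Summable (eulerTerm x d) :=
  Summable.of_norm_bounded (summable_inv_qProd hx) (norm_eulerTerm_le hx d)

/-- The `q`-difference equation of Euler's series. -/
theorem tsum_eulerTerm_eq_mul {x : ℝ} (hx : 1 < x) (d : ℕ) :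
    ∑' i, eulerTerm x d i = (1 - (x ^ (d + 1))⁻¹) * ∑' i, eulerTerm x (d + 1) i := by
  have hx0 : x ≠ 0 := by positivity
  have h0 : ∀ d, eulerTerm x d 0 = 1 := fun d => by simp [eulerTerm, qProd]
  have hstep : ∀ i, eulerTerm x d (i + 1) =
      eulerTerm x (d + 1) (i + 1) - (x ^ (d + 1))⁻¹ * eulerTerm x (d + 1) i := by
    intro i
    have h1 := (qProd_pos hx i).ne'
    have h2 : x ^ (i + 1) - 1 ≠ 0 := (sub_pos.2 (one_lt_pow₀ hx i.succ_ne_zero)).ne'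
    simp only [eulerTerm, qProd_succ]
    field_simp
    ring
  have hs := (summable_nat_add_iff 1).2 (summable_eulerTerm hx (d + 1))
  have hs' := (summable_eulerTerm hx (d + 1)).mul_left (x ^ (d + 1))⁻¹
  rw [(summable_eulerTerm hx d).tsum_eq_zero_add]
  simp only [hstep]
  rw [hs.tsum_sub hs', tsum_mul_left, sub_mul, one_mul, h0, ← h0 (d + 1), ← add_sub_assoc,
    ← (summable_eulerTerm hx (d + 1)).tsum_eq_zero_add]

theorem tendsto_tsum_eulerTerm {x : ℝ} (hx : 1 < x) :
    Tendsto (fun d => ∑' i, eulerTerm x d i) atTop (𝓝 1) := by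
  have h := tendsto_tsum_of_dominated_convergence (f := eulerTerm x) (𝓕 := atTop)
    (g := fun i => if i = 0 then 1 else 0) (summable_inv_qProd hx) (fun i => ?_)
    (Eventually.of_forall (norm_eulerTerm_le hx))
  · rwa [tsum_ite_eq] at h
  rcases i with _ | i
  · simp [eulerTerm, qProd]
  · have h1 : Tendsto (fun d : ℕ => (x ^ (d * (i + 1)))⁻¹) atTop (𝓝 0) :=
      tendsto_inv_atTop_zero.comp ((tendsto_pow_atTop_atTop_of_one_lt hx).comp
        (tendsto_id.atTop_mul_const' i.succ_pos))
    simpa [eulerTerm] using (h1.const_mul ((-1) ^ (i + 1))).div_const (qProd x (i + 1))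

theorem multipliable_one_sub_inv_pow {x : ℝ} (hx : 1 < x) (d : ℕ) :
    Multipliable fun j : ℕ => 1 - (x ^ (d + 1 + j))⁻¹ := by
  simp only [sub_eq_add_neg]
  refine Real.multipliable_one_add_of_summable (Summable.neg ?_)
  simp only [pow_add, mul_inv, ← inv_pow]
  exact (summable_geometric_of_lt_one (by positivity) (inv_lt_one_of_one_lt₀ hx)).mul_left _

/-- Euler's identity. -/
theorem tsum_eulerTerm {x : ℝ} (hx : 1 < x) (d : ℕ) :
    ∑' i, eulerTerm x d i = ∏' j : ℕ, (1 - (x ^ (d + 1 + j))⁻¹) := by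
  have hN : ∀ N, ∑' i, eulerTerm x d i =
      (∏ j ∈ Finset.range N, (1 - (x ^ (d + 1 + j))⁻¹)) * ∑' i, eulerTerm x (N + d) i := by
    intro N
    induction N with
    | zero => simp
    | succ N ih =>
      rw [ih, tsum_eulerTerm_eq_mul hx (N + d), Finset.prod_range_succ, mul_assoc]
      congr 3 <;> ring_nf
  have h := (multipliable_one_sub_inv_pow hx d).tendsto_prod_tprod_nat.mul
    ((tendsto_add_atTop_iff_nat d).2 (tendsto_tsum_eulerTerm hx))
  rw [mul_one] at h
  exact tendsto_nhds_unique (tendsto_const_nhds.congr hN) h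

/-- The order of `GL_d` over a field of `x` elements, with its powers of `x` extracted. -/
theorem prod_range_pow_sub_pow {x : ℝ} (hx : x ≠ 0) (d : ℕ) :
    ∏ j ∈ Finset.range d, (x ^ d - x ^ j) =
      x ^ (d ^ 2) * ∏ i ∈ Finset.Icc 1 d, (1 - (x ^ i)⁻¹) := by
  have h : ∏ i ∈ Finset.Icc 1 d, (1 - (x ^ i)⁻¹) =
      ∏ j ∈ Finset.range d, (1 - (x ^ (d - j))⁻¹) := by
    rw [← Finset.prod_range_reflect, ← Finset.Ico_add_one_right_eq_Icc,
      Finset.prod_Ico_eq_prod_range]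
    refine Finset.prod_congr rfl fun j hj => ?_
    have := Finset.mem_range.1 hj
    rw [show d - (d - 1 - j) = 1 + j by omega]
  have h2 : x ^ (d ^ 2) = ∏ _j ∈ Finset.range d, x ^ d := by simp [← pow_mul, sq]
  rw [h, h2, ← Finset.prod_mul_distrib]
  refine Finset.prod_congr rfl fun j hj => ?_
  have := Finset.mem_range.1 hj
  rw [mul_sub, mul_one, pow_sub₀ x hx this.le]
  field_simp

end Euler

/-! ### The limit distribution -/

section Limit

variable {p : ℕ} [Fact p.Prime] {k : Type*} [Field k] [CharP k p] [Finite k]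

namespace PqpDBT1

/-- The expected number of `k`-independent `m`-tuples on which `V` agrees with a random symplectic
matrix; equivalently, of injections from `F_p ^ m` into the group of rational points of a random
`DBT₁`. -/
noncomputable def moment {g : ℕ} (D : PqpDBT1 p k g) (m : ℕ) : ℝ :=
  (Nat.card (D.coincidencePairs m) : ℝ) / Nat.card (Matrix.symplecticGroup (Fin g) k)

theorem norm_moment_le_one {g : ℕ} (D : PqpDBT1 p k g) (m : ℕ) : ‖D.moment m‖ ≤ 1 := by
  rw [moment, Real.norm_of_nonneg (by positivity)]
  exact div_le_one_of_le₀ (Nat.cast_le.2 (D.card_coincidencePairs_le m)) (Nat.cast_nonneg _)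

theorem tendsto_moment (D : ∀ g : ℕ, PqpDBT1 p k g) (m : ℕ) :
    Tendsto (fun g => (D g).moment m) atTop (𝓝 1) := by
  have hq : (1 : ℝ) < Nat.card k := Nat.one_lt_cast.2 Finite.one_lt_card
  have hlow : Tendsto (fun g : ℕ => 1 - (Nat.card k : ℝ) ^ m * ((Nat.card k : ℝ) ^ g)⁻¹) atTop
      (𝓝 1) := by
    have h := (tendsto_inv_atTop_zero.comp (tendsto_pow_atTop_atTop_of_one_lt hq)).const_mul
      ((Nat.card k : ℝ) ^ m)
    simpa using h.const_sub 1
  refine tendsto_of_tendsto_of_tendsto_of_le_of_le' hlow tendsto_const_nhds ?_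
    (Eventually.of_forall fun g => (le_abs_self _).trans ((D g).norm_moment_le_one m))
  filter_upwards [eventually_ge_atTop m] with g hg
  have h : (Nat.card (Matrix.symplecticGroup (Fin g) k) : ℝ) * (Nat.card k : ℝ) ^ g ≤
      Nat.card ((D g).coincidencePairs m) * (Nat.card k : ℝ) ^ g +
        (Nat.card k : ℝ) ^ m * Nat.card (Matrix.symplecticGroup (Fin g) k) := by
    exact_mod_cast (D g).le_card_coincidencePairs hg
  have hS : (0 : ℝ) < Nat.card (Matrix.symplecticGroup (Fin g) k) := Nat.cast_pos.2 Nat.card_pos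
  have hqg : (0 : ℝ) < (Nat.card k : ℝ) ^ g := by positivity
  rw [moment, le_div_iff₀ hS]
  refine le_of_mul_le_mul_right ?_ hqg
  have h2 : (1 - (Nat.card k : ℝ) ^ m * ((Nat.card k : ℝ) ^ g)⁻¹) *
      Nat.card (Matrix.symplecticGroup (Fin g) k) * (Nat.card k : ℝ) ^ g =
      Nat.card (Matrix.symplecticGroup (Fin g) k) * (Nat.card k : ℝ) ^ g -
        (Nat.card k : ℝ) ^ m * Nat.card (Matrix.symplecticGroup (Fin g) k) := by
    field_simp
  rw [h2]
  linarith

/-- The probability as a series in the moments. -/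
theorem hasSum_moment {g : ℕ} (D : PqpDBT1 p k g) (d : ℕ) :
    HasSum (fun i => eulerTerm p d i /
      (∏ j ∈ Finset.range d, ((p : ℝ) ^ d - (p : ℝ) ^ j)) * D.moment (d + i))
      (D.prob fun D' => Nat.card D'.rationalPoints = p ^ d) := by
  classical
  let _ : Fintype (Matrix.symplecticGroup (Fin g) k) := Fintype.ofFinite _
  have hp : (1 : ℝ) < p := Nat.one_lt_cast.2 (Fact.out : p.Prime).one_lt
  have h1 : ∀ C : Matrix.symplecticGroup (Fin g) k, HasSum (fun i => eulerTerm p d i /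
      (∏ j ∈ Finset.range d, ((p : ℝ) ^ d - (p : ℝ) ^ j)) *
        ∏ j ∈ Finset.range (d + i), ((Nat.card (D.coincidences C) : ℝ) - (p : ℝ) ^ j))
      (if Nat.card (D.coincidences C) = p ^ d then 1 else 0) := by
    intro C
    obtain ⟨n, hn⟩ := D.exists_card_coincidences C
    have h := hasSum_eulerTerm_mul_prod hp d n
    simpa [hn, (Nat.pow_right_injective (Fact.out : p.Prime).two_le).eq_iff] using h
  have h2 := (hasSum_sum fun C (_ : C ∈ Finset.univ) => h1 C).div_const
    (Nat.card (Matrix.symplecticGroup (Fin g) k) : ℝ)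
  rw [Finset.sum_boole, ← Fintype.card_subtype, ← Nat.card_eq_fintype_card] at h2
  rw [prob_card_rationalPoints]
  simp only [moment, card_coincidencePairs_eq_sum, ← mul_div_assoc, Finset.mul_sum]
  exact h2

end PqpDBT1

end Limit

theorem propositionP (p : ℕ) [Fact p.Prime] (k : Type*) [Field k] [Finite k] [CharP k p]
    (D₀ : ∀ g : ℕ, PqpDBT1 p k g) (d : ℕ) :
    Multipliable (fun j : ℕ => 1 - ((p : ℝ) ^ (d + 1 + j))⁻¹) ∧
    Tendsto (fun g : ℕ => (D₀ g).prob fun D => Nat.card D.rationalPoints = p ^ d) atTop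
      (𝓝 (((p : ℝ) ^ (d ^ 2))⁻¹ * (∏ i ∈ Finset.Icc 1 d, (1 - ((p : ℝ) ^ i)⁻¹)⁻¹) *
        ∏' j : ℕ, (1 - ((p : ℝ) ^ (d + 1 + j))⁻¹))) := by
  have hp : (1 : ℝ) < p := Nat.one_lt_cast.2 (Fact.out : p.Prime).one_lt
  refine ⟨multipliable_one_sub_inv_pow hp d, ?_⟩
  set c := ∏ j ∈ Finset.range d, ((p : ℝ) ^ d - (p : ℝ) ^ j) with hc
  have hlim := tendsto_tsum_of_dominated_convergence (𝓕 := atTop)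
    (f := fun g i => eulerTerm p d i / c * (D₀ g).moment (d + i))
    (g := fun i => eulerTerm p d i / c) (bound := fun i => ‖eulerTerm p d i / c‖)
    ((summable_eulerTerm hp d).div_const c).norm
    (fun i => by simpa using (PqpDBT1.tendsto_moment D₀ (d + i)).const_mul (eulerTerm p d i / c))
    (Eventually.of_forall fun g i => by
      rw [norm_mul]
      exact mul_le_of_le_one_right (norm_nonneg _) ((D₀ g).norm_moment_le_one _))
  have hprob := hlim.congr fun g => ((D₀ g).hasSum_moment d).tsum_eq
  rwa [tsum_div_const, tsum_eulerTerm hp, hc, prod_range_pow_sub_pow (by positivity),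
    div_eq_inv_mul, mul_inv, ← Finset.prod_inv_distrib] at hprob
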